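/- Let $T>0$, $I=[0,T]$, and let $\mathbb T^2=(\mathbb R/\mathbb Z)^2$. Let $n\geq 3$ be odd and let $$F(t,y)=\sum_{j=0}^n A_j(t)\,y^j ,$$ where $A_0,\dots,A_n:I\to\mathbb R$ are of class $C^1$ and $A_n(t)<0$ for all $t\in I$. Assume that there is a continuous map $\phi^*:I\to\mathbb R$ with $F(t,\phi^*(t))=0$ for all $t\in I$, and constants $a_+>a_->0$ such that $$-a_+<\partial_y F(t,\phi^*(t))<-a_-\qquad\forall t\in I .$$ Then there exist constants $\varepsilon_0,C>0$ such that, for every $\varepsilon\in(0,\varepsilon_0)$, the equation $$\partial_t\phi(t,x)=\frac1\varepsilon\bigl[\Delta\phi(t,x)+F(t,\phi(t,x))\bigr],\qquad t\in I,\ x\in\mathbb T^2,$$ admits a real-valued classical solution $\bar\phi$ on $I\times\mathbb T^2$ (that is, $\partial_t\bar\phi$ and all spatial derivatives of $\bar\phi$ of order at most two exist and are continuous on $I\times\mathbb T^2$, time derivatives being one-sided at the end points of $I$) satisfying $$\|\bar\phi(t,\cdot)-\phi^*(t)\|_{H^1(\mathbb T^2)}\leq C\varepsilon\qquad\forall t\in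 I ,$$ where $\phi^*(t)$ is regarded as a constant function on $\mathbb T^2$ and $\|f\|_{H^1(\mathbb T^2)}^2=\|f\|_{L^2}^2+\|\nabla f\|_{L^2}^2=\sum_{k\in\mathbb Z^2}(1+4\pi^2|k|^2)\,|\hat f(k)|^2$, with $|k|$ the Euclidean norm and $\hat f(k)$ the Fourier coefficients of $f$. -/

import Mathlib

open MeasureTheory
open scoped ENNReal

noncomputable section

/-- The two-dimensional torus `(ℝ/ℤ)²`. -/
abbrev Torus2 : Type := UnitAddTorus (Fin 2)

/-- The `ℤ²`-periodic function on the plane that corresponds to a function on the torus.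
Spatial derivatives of `u` are by definition those of this function. -/
def periodicLift (u : Torus2 → ℝ) (x : EuclideanSpace ℝ (Fin 2)) : ℝ :=
  u fun i => (x i : UnitAddCircle)

/-- The polynomial `F(t, y) = ∑_{j=0}^n A_j(t) y^j`. -/
def forcing {n : ℕ} (A : Fin (n + 1) → ℝ → ℝ) (t y : ℝ) : ℝ :=
  ∑ j : Fin (n + 1), A j t * y ^ (j : ℕ)

/-- The `H¹` norm of a real function on the torus, as an extended nonnegative number:
`‖f‖² = ∑_k (1 + (2π)² |k|²) |f_k|² = ‖f‖²_{L²} + ‖∇f‖²_{L²}`, with `|k|` the Euclidean norm and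
`f_k` the Fourier coefficients; it is `∞` if `f` is not in `L²`. -/
def sobolevH1Norm (f : Torus2 → ℝ) : ℝ≥0∞ :=
  open Classical in
  if MemLp f 2 (volume : Measure Torus2) then
    (∑' k : Fin 2 → ℤ,
      ENNReal.ofReal (1 + (2 * Real.pi) ^ 2 * ((k 0 : ℝ) ^ 2 + (k 1 : ℝ) ^ 2)) *
        ‖UnitAddTorus.mFourierCoeff (fun x => (f x : ℂ)) k‖ₑ ^ 2) ^ (1 / 2 : ℝ)
  else ∞

/-- `φ` is a classical (`C^{1,2}`) solution of `∂_t φ = ε⁻¹ [Δφ + F(t, φ)]` on `[0, T] × (ℝ/ℤ)²`;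
the time derivative is one-sided at `t = 0` and `t = T`. Continuity of the time derivative
follows from the equation when `F` is continuous. -/
structure IsClassicalSolution (T ε : ℝ) (F : ℝ → ℝ → ℝ) (φ : ℝ → Torus2 → ℝ) : Prop where
  contDiff_space : ∀ t ∈ Set.Icc 0 T, ContDiff ℝ 2 (periodicLift (φ t))
  continuousOn_deriv : ∀ m ≤ 2, ContinuousOn
    (fun p : ℝ × EuclideanSpace ℝ (Fin 2) => iteratedFDeriv ℝ m (periodicLift (φ p.1)) p.2)
    (Set.Icc 0 T ×ˢ Set.univ)
  equation : ∀ t ∈ Set.Icc 0 T, ∀ x : EuclideanSpace ℝ (Fin 2),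
    HasDerivWithinAt (fun s => periodicLift (φ s) x)
      (ε⁻¹ * (Laplacian.laplacian (periodicLift (φ t)) x + F t (periodicLift (φ t) x)))
      (Set.Icc 0 T) t

end

/-! The solution is spatially constant: it is the solution `y` of `ε y' = F(t, y)` that starts on
the branch `φ*`, and the `H¹` norm of a constant is its absolute value. The branch is `C¹` by
implicit differentiation, and `F(t, ·)` decreases at a uniform rate near it, so that for large `C`
the curves `φ* - C ε` and `φ* + C ε` are a strict lower and a strict upper solution that enclose
`y`. -/

open Set Function Filter Topology

theorem exists_forall_hasDerivWithinAt_of_bounded_of_lipschitz {E : Type*} [NormedAddCommGroup E]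
    [NormedSpace ℝ E] [CompleteSpace E] {f : ℝ → E → E} {a b : ℝ} {K L : NNReal} (hab : a ≤ b)
    (hcont : ∀ x, ContinuousOn (f · x) (Icc a b))
    (hbound : ∀ t ∈ Icc a b, ∀ x, ‖f t x‖ ≤ L)
    (hlip : ∀ t ∈ Icc a b, LipschitzWith K (f t)) (x₀ : E) :
    ∃ y : ℝ → E, y a = x₀ ∧ ∀ t ∈ Icc a b, HasDerivWithinAt y (f t (y t)) (Icc a b) t := by
  have hpicard : IsPicardLindelof f ⟨a, left_mem_Icc.2 hab⟩ x₀ (L * (b - a).toNNReal) 0 L K :=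
    { lipschitzOnWith := fun t ht => (hlip t ht).lipschitzOnWith
      continuousOn := fun x _ => hcont x
      norm_le := fun t ht x _ => hbound t ht x
      mul_max_le := by simp [hab] }
  exact hpicard.exists_eq_forall_mem_Icc_hasDerivWithinAt₀

theorem exists_solution_clamped {f : ℝ → ℝ → ℝ} {α β : ℝ → ℝ} {a b : ℝ} {K : NNReal}
    (hab : a ≤ b) (hα : ContinuousOn α (Icc a b)) (hβ : ContinuousOn β (Icc a b))
    (hαβ : ∀ t ∈ Icc a b, α t ≤ β t)
    (hcont : ContinuousOn (uncurry f) {p | p.1 ∈ Icc a b ∧ p.2 ∈ Icc (α p.1) (β p.1)})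
    (hlip : ∀ t ∈ Icc a b, LipschitzOnWith K (f t) (Icc (α t) (β t))) (x₀ : ℝ) :
    ∃ y : ℝ → ℝ, y a = x₀ ∧ ∀ t ∈ Icc a b,
      HasDerivWithinAt y (f t (max (α t) (min (β t) (y t)))) (Icc a b) t := by
  set c : ℝ → ℝ → ℝ := fun t x => max (α t) (min (β t) x)
  have hc_mem : ∀ t ∈ Icc a b, ∀ x, c t x ∈ Icc (α t) (β t) := fun t ht x =>
    ⟨le_max_left _ _, max_le (hαβ t ht) (min_le_left _ _)⟩
  have hclamped_cont (x : ℝ) : ContinuousOn (fun t => f t (c t x)) (Icc a b) :=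
    hcont.comp (continuousOn_id.prodMk (hα.sup (hβ.inf continuousOn_const)))
      fun t ht => ⟨ht, hc_mem t ht x⟩
  have hclamped_lip (t : ℝ) (ht : t ∈ Icc a b) : LipschitzWith K (fun x => f t (c t x)) := by
    have hc_lip : LipschitzWith 1 (c t) := (LipschitzWith.id.const_min (β t)).const_max (α t)
    rw [← lipschitzOnWith_univ, ← mul_one K]
    exact (hlip t ht).comp hc_lip.lipschitzOnWith fun x _ => hc_mem t ht x
  have hfα : ContinuousOn (fun t => f t (α t)) (Icc a b) :=
    hcont.comp (continuousOn_id.prodMk hα) fun t ht => ⟨ht, le_rfl, hαβ t ht⟩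
  obtain ⟨L₁, hL₁⟩ := isCompact_Icc.exists_bound_of_continuousOn hfα
  obtain ⟨L₂, hL₂⟩ := isCompact_Icc.exists_bound_of_continuousOn (hβ.sub hα)
  have hbound : ∀ t ∈ Icc a b, ∀ x, ‖f t (c t x)‖ ≤ (L₁ + K * L₂).toNNReal := by
    refine fun t ht x => le_trans ?_ (Real.le_coe_toNNReal _)
    have hdist : ‖c t x - α t‖ ≤ ‖β t - α t‖ := by
      rw [Real.norm_of_nonneg (sub_nonneg.2 (hc_mem t ht x).1),
        Real.norm_of_nonneg (sub_nonneg.2 (hαβ t ht))]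
      exact sub_le_sub_right (hc_mem t ht x).2 _
    calc ‖f t (c t x)‖ ≤ ‖f t (α t)‖ + ‖f t (c t x) - f t (α t)‖ := norm_le_norm_add_norm_sub' _ _
      _ ≤ ‖f t (α t)‖ + K * ‖c t x - α t‖ := by
        gcongr
        exact (hlip t ht).norm_sub_le (hc_mem t ht x) ⟨le_rfl, hαβ t ht⟩
      _ ≤ L₁ + K * L₂ := by
        gcongr
        exacts [hL₁ t ht, hdist.trans (hL₂ t ht)]
  exact exists_forall_hasDerivWithinAt_of_bounded_of_lipschitz hab hclamped_cont hbound
    hclamped_lip x₀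

/-- Strict lower and upper solutions `α` and `β` confine a solution: the solution of the clamped
equation cannot cross them, so it never feels the clamping. -/
theorem exists_solution_between {f : ℝ → ℝ → ℝ} {α β α' β' : ℝ → ℝ} {a b x₀ : ℝ} {K : NNReal}
    (hα : ∀ t ∈ Icc a b, HasDerivWithinAt α (α' t) (Icc a b) t)
    (hβ : ∀ t ∈ Icc a b, HasDerivWithinAt β (β' t) (Icc a b) t)
    (hαβ : ∀ t ∈ Icc a b, α t ≤ β t)
    (hcont : ContinuousOn (uncurry f) {p | p.1 ∈ Icc a b ∧ p.2 ∈ Icc (α p.1) (β p.1)})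
    (hlip : ∀ t ∈ Icc a b, LipschitzOnWith K (f t) (Icc (α t) (β t)))
    (hlower : ∀ t ∈ Ico a b, α' t < f t (α t)) (hupper : ∀ t ∈ Ico a b, f t (β t) < β' t)
    (hab : a ≤ b) (hx₀ : x₀ ∈ Icc (α a) (β a)) :
    ∃ y : ℝ → ℝ, y a = x₀ ∧ ∀ t ∈ Icc a b,
      HasDerivWithinAt y (f t (y t)) (Icc a b) t ∧ y t ∈ Icc (α t) (β t) := by
  have hαc : ContinuousOn α (Icc a b) := HasDerivWithinAt.continuousOn hα
  have hβc : ContinuousOn β (Icc a b) := HasDerivWithinAt.continuousOn hβ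
  obtain ⟨y, hya, hy⟩ := exists_solution_clamped hab hαc hβc hαβ hcont hlip x₀
  have hyc : ContinuousOn y (Icc a b) := HasDerivWithinAt.continuousOn hy
  have hderiv_right {g g' : ℝ → ℝ} (hg : ∀ t ∈ Icc a b, HasDerivWithinAt g (g' t) (Icc a b) t)
      (t : ℝ) (ht : t ∈ Ico a b) : HasDerivWithinAt g (g' t) (Ici t) t :=
    (hg t (Ico_subset_Icc_self ht)).mono_of_mem_nhdsWithin (Icc_mem_nhdsGE_of_mem ht)
  have hclamp_eq : ∀ t x, x ∈ Icc (α t) (β t) → max (α t) (min (β t) x) = x :=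
    fun t x hx => by simp [hx.1, hx.2]
  have hαy : ∀ t ∈ Icc a b, α t ≤ y t :=
    image_le_of_deriv_right_lt_deriv_boundary' hαc (hderiv_right hα) (hya ▸ hx₀.1) hyc
      (hderiv_right hy) fun t ht hcontact => by
        rw [← hcontact, hclamp_eq t _ ⟨le_rfl, hαβ t (Ico_subset_Icc_self ht)⟩]
        exact hlower t ht
  have hyβ : ∀ t ∈ Icc a b, y t ≤ β t :=
    image_le_of_deriv_right_lt_deriv_boundary' hyc (hderiv_right hy) (hya ▸ hx₀.2) hβc
      (hderiv_right hβ) fun t ht hcontact => by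
        rw [hcontact, hclamp_eq t _ ⟨hαβ t (Ico_subset_Icc_self ht), le_rfl⟩]
        exact hupper t ht
  refine ⟨y, hya, fun t ht => ?_⟩
  have hmem : y t ∈ Icc (α t) (β t) := ⟨hαy t ht, hyβ t ht⟩
  exact ⟨by simpa only [hclamp_eq t _ hmem] using hy t ht, hmem⟩

theorem hasFDerivWithinAt_of_implicit {𝕜 E G H : Type*} [NontriviallyNormedField 𝕜]
    [NormedAddCommGroup E] [NormedSpace 𝕜 E] [NormedAddCommGroup G] [NormedSpace 𝕜 G]
    [NormedAddCommGroup H] [NormedSpace 𝕜 H] {F : E × G → H} {F' : E × G →L[𝕜] H}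
    {e : G ≃L[𝕜] H} {φ : E → G} {s : Set E} {x : E} {c : H}
    (hF : HasFDerivWithinAt F F' (s ×ˢ univ) (x, φ x))
    (he : F' ∘L ContinuousLinearMap.inr 𝕜 E G = e)
    (hφ : ContinuousWithinAt φ s x) (hx : x ∈ s) (hlevel : ∀ z ∈ s, F (z, φ z) = c) :
    HasFDerivWithinAt φ (-(e.symm ∘L F' ∘L ContinuousLinearMap.inl 𝕜 E G)) s x := by
  -- `z ↦ (z, φ z)` inverts `(z, y) ↦ (z, F (z, y))`, whose derivative has an explicit left inverse.
  have hgraph : Tendsto (fun z => (z, φ z)) (𝓝[s] x) (𝓝[s ×ˢ univ] (x, φ x)) := by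
    rw [nhdsWithin_prod_eq, nhdsWithin_univ]
    exact tendsto_id.prodMk hφ
  have hpair := (hasFDerivWithinAt_fst (𝕜 := 𝕜)).prodMk hF
  have hlevel' : (fun p : E × G => (p.1, F p)) ∘ (fun z => (z, φ z)) =ᶠ[𝓝[s] x]
      fun z => (z, c) :=
    eventually_nhdsWithin_of_forall fun z hz => by simp [hlevel z hz]
  have hinv : LeftInverse
      ((ContinuousLinearMap.fst 𝕜 E H).prod (e.symm ∘L (ContinuousLinearMap.snd 𝕜 E H -
        F' ∘L ContinuousLinearMap.inl 𝕜 E G ∘L ContinuousLinearMap.fst 𝕜 E H)))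
      ((ContinuousLinearMap.fst 𝕜 E G).prod F') := by
    rintro ⟨u, v⟩
    have hsplit : F' (u, v) = F' (u, 0) + e v := by
      rw [← e.coe_coe, ← he, ContinuousLinearMap.comp_apply, ← map_add]
      simp
    simp [hsplit]
  have hderiv := (HasFDerivWithinAt.of_comp_of_leftInverse hgraph hpair
    ((hasFDerivWithinAt_id x s).prodMk (hasFDerivWithinAt_const c x s)) hlevel' hinv hx).snd
  refine hderiv.congr_fderiv ?_
  ext u
  simp

theorem hasDerivAt_of_hasFDerivWithinAt_uncurry {F : ℝ → ℝ → ℝ} {F' : ℝ × ℝ →L[ℝ] ℝ} {s : Set ℝ}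
    {t y : ℝ} (hF : HasFDerivWithinAt (uncurry F) F' (s ×ˢ univ) (t, y)) (ht : t ∈ s) :
    HasDerivAt (F t) (F' (0, 1)) y := by
  have h : HasDerivAt (fun y : ℝ => (t, y)) ((0 : ℝ), (1 : ℝ)) y :=
    (hasDerivAt_const y t).prodMk (hasDerivAt_id y)
  exact hF.comp_hasDerivAt y h (.of_forall fun z => ⟨ht, mem_univ z⟩)

theorem continuousOn_deriv_snd_of_contDiffOn {F : ℝ → ℝ → ℝ} {s : Set ℝ} (hs : UniqueDiffOn ℝ s)
    (hF : ContDiffOn ℝ 1 (uncurry F) (s ×ˢ univ)) :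
    ContinuousOn (fun p : ℝ × ℝ => deriv (F p.1) p.2) (s ×ˢ univ) := by
  refine ((hF.continuousOn_fderivWithin (hs.prod uniqueDiffOn_univ) le_rfl).clm_apply
    (continuousOn_const (c := ((0 : ℝ), (1 : ℝ))))).congr fun p hp => ?_
  exact (hasDerivAt_of_hasFDerivWithinAt_uncurry
    (hF.differentiableOn one_ne_zero p hp).hasFDerivWithinAt hp.1).deriv

/-- Implicit function theorem along a branch of zeros that is already known to be continuous. -/
theorem contDiffOn_zero_branch {F : ℝ → ℝ → ℝ} {φ : ℝ → ℝ} {s : Set ℝ} (hs : UniqueDiffOn ℝ s)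
    (hF : ContDiffOn ℝ 1 (uncurry F) (s ×ˢ univ)) (hφ : ContinuousOn φ s)
    (hzero : ∀ t ∈ s, F t (φ t) = 0) (hderiv : ∀ t ∈ s, deriv (F t) (φ t) ≠ 0) :
    ContDiffOn ℝ 1 φ s := by
  set F' : ℝ → ℝ × ℝ →L[ℝ] ℝ := fun t => fderivWithin ℝ (uncurry F) (s ×ˢ univ) (t, φ t)
  have hF' : ∀ t ∈ s, HasFDerivWithinAt (uncurry F) (F' t) (s ×ˢ univ) (t, φ t) := fun t ht =>
    (hF.differentiableOn one_ne_zero (t, φ t) ⟨ht, mem_univ _⟩).hasFDerivWithinAt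
  have hF'c : ContinuousOn F' s :=
    (hF.continuousOn_fderivWithin (hs.prod uniqueDiffOn_univ) le_rfl).comp
      (continuousOn_id.prodMk hφ) fun t ht => ⟨ht, mem_univ _⟩
  have hF'snd : ∀ t ∈ s, F' t (0, 1) ≠ 0 := fun t ht => by
    rw [← (hasDerivAt_of_hasFDerivWithinAt_uncurry (hF' t ht) ht).deriv]
    exact hderiv t ht
  have hφ' : ∀ t ∈ s, HasDerivWithinAt φ (-(F' t (1, 0) / F' t (0, 1))) s t := fun t ht => by
    set e := ContinuousLinearEquiv.unitsEquivAut ℝ (Units.mk0 _ (hF'snd t ht))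
    have he : F' t ∘L ContinuousLinearMap.inr ℝ ℝ ℝ = e := by ext; simp [e]
    simpa [e, div_eq_mul_inv] using
      (hasFDerivWithinAt_of_implicit (hF' t ht) he (hφ t ht) ht hzero).hasDerivWithinAt
  refine (contDiffOn_one_iff_derivWithin hs).2
    ⟨fun t ht => (hφ' t ht).differentiableWithinAt, ?_⟩
  exact ((hF'c.clm_apply continuousOn_const).div (hF'c.clm_apply continuousOn_const)
    hF'snd).neg.congr fun t ht => (hφ' t ht).derivWithin (hs t ht)

theorem exists_forall_lipschitzOnWith_Icc {F : ℝ → ℝ → ℝ} {α β : ℝ → ℝ} {a b : ℝ}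
    (hF : ContDiffOn ℝ 1 (uncurry F) (Icc a b ×ˢ univ)) (hα : ContinuousOn α (Icc a b))
    (hβ : ContinuousOn β (Icc a b)) :
    ∃ K : NNReal, ∀ t ∈ Icc a b, LipschitzOnWith K (F t) (Icc (α t) (β t)) := by
  obtain ⟨p, hp⟩ := (isCompact_Icc.image_of_continuousOn hα).bddBelow
  obtain ⟨q, hq⟩ := (isCompact_Icc.image_of_continuousOn hβ).bddAbove
  obtain ⟨K, hK⟩ := (hF.mono (prod_mono_right (subset_univ (Icc p q)))).exists_lipschitzOnWith
    one_ne_zero ((convex_Icc a b).prod (convex_Icc p q)) (isCompact_Icc.prod isCompact_Icc)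
  refine ⟨K, fun t ht => ?_⟩
  have hmaps : MapsTo (Prod.mk t) (Icc (α t) (β t)) (Icc a b ×ˢ Icc p q) := fun x hx =>
    ⟨ht, (hp (mem_image_of_mem α ht)).trans hx.1, hx.2.trans (hq (mem_image_of_mem β ht))⟩
  simpa using! hK.comp (LipschitzWith.prodMk_left t).lipschitzOnWith hmaps

theorem exists_forall_closedBall_le_neg {X Y : Type*} [TopologicalSpace X] [PseudoMetricSpace Y]
    [ProperSpace Y] {g : X × Y → ℝ} {K : Set X} {y : Y} (hK : IsCompact K)
    (hg : ContinuousOn g (K ×ˢ univ)) (hneg : ∀ x ∈ K, g (x, y) < 0) :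
    ∃ m > 0, ∃ r > 0, ∀ x ∈ K, ∀ z ∈ Metric.closedBall y r, g (x, z) ≤ -m := by
  obtain ⟨U, hU, hgU⟩ := continuousOn_iff'.1 hg (Iio 0) isOpen_Iio
  have hKU : K ×ˢ {y} ⊆ U := by
    rintro ⟨x, z⟩ ⟨hx, rfl⟩
    exact (hgU.le ⟨hneg x hx, hx, mem_univ _⟩).1
  obtain ⟨V, W, -, hW, hKV, hyW, hVW⟩ := generalized_tube_lemma hK isCompact_singleton hU hKU
  obtain ⟨r, hr, hrW⟩ := Metric.nhds_basis_closedBall.mem_iff.1 (hW.mem_nhds (hyW rfl))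
  have hneg' : ∀ p ∈ K ×ˢ Metric.closedBall y r, 0 < -g p := fun p hp =>
    neg_pos.2 (hgU.ge ⟨hVW ⟨hKV hp.1, hrW hp.2⟩, hp.1, mem_univ _⟩).1
  obtain ⟨m, hm, hgm⟩ := (hK.prod (isCompact_closedBall y r)).exists_forall_le'
    (hg.mono (prod_mono_right (subset_univ _))).neg hneg'
  exact ⟨m, hm, r, hr, fun x hx z hz => le_neg_of_le_neg (hgm (x, z) ⟨hx, hz⟩)⟩

theorem exists_linear_bound_near_stable_branch {F : ℝ → ℝ → ℝ} {φ : ℝ → ℝ} {s : Set ℝ}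
    (hs : UniqueDiffOn ℝ s) (hsc : IsCompact s)
    (hF : ContDiffOn ℝ 1 (uncurry F) (s ×ˢ univ)) (hφ : ContinuousOn φ s)
    (hzero : ∀ t ∈ s, F t (φ t) = 0) (hstable : ∀ t ∈ s, deriv (F t) (φ t) < 0) :
    ∃ m > 0, ∃ r > 0, ∀ t ∈ s, ∀ u ∈ Icc 0 r,
      F t (φ t + u) ≤ -(m * u) ∧ m * u ≤ F t (φ t - u) := by
  have hdiff : ∀ t ∈ s, Differentiable ℝ (F t) := fun t ht y =>
    (hasDerivAt_of_hasFDerivWithinAt_uncurry (hF.differentiableOn one_ne_zero (t, y)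
      ⟨ht, mem_univ _⟩).hasFDerivWithinAt ht).differentiableAt
  have hshift : ContinuousOn (fun p : ℝ × ℝ => deriv (F p.1) (φ p.1 + p.2)) (s ×ˢ univ) :=
    (continuousOn_deriv_snd_of_contDiffOn hs hF).comp (continuousOn_fst.prodMk
      ((hφ.comp continuousOn_fst fun p hp => hp.1).add continuousOn_snd))
      fun p hp => ⟨hp.1, mem_univ _⟩
  obtain ⟨m, hm, r, hr, hle⟩ := exists_forall_closedBall_le_neg (y := 0) hsc hshift
    (by simpa using hstable)
  have hdecay : ∀ t ∈ s, ∀ u v, -r ≤ u → u ≤ v → v ≤ r →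
      F t (φ t + v) - F t (φ t + u) ≤ -m * (v - u) := fun t ht u v hu huv hv => by
    have hderiv : ∀ x ∈ interior (Icc (φ t + u) (φ t + v)), deriv (F t) x ≤ -m := fun x hx => by
      rw [interior_Icc] at hx
      have hmem : x - φ t ∈ Metric.closedBall 0 r := by
        rw [mem_closedBall_zero_iff, Real.norm_eq_abs, abs_le]
        constructor <;> linarith [hx.1, hx.2]
      simpa only [add_sub_cancel] using hle t ht _ hmem
    have hmean := (convex_Icc (φ t + u) (φ t + v)).image_sub_le_mul_sub_of_deriv_le
      (hdiff t ht).continuous.continuousOn (hdiff t ht).differentiableOn hderiv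
      (φ t + u) (left_mem_Icc.2 (by linarith)) (φ t + v) (right_mem_Icc.2 (by linarith))
      (by linarith)
    rwa [add_sub_add_left_eq_sub] at hmean
  refine ⟨m, hm, r, hr, fun t ht u hu => ⟨?_, ?_⟩⟩
  · have habove := hdecay t ht 0 u (by linarith) hu.1 hu.2
    rw [add_zero, hzero t ht] at habove
    linarith
  · have hbelow := hdecay t ht (-u) 0 (by linarith [hu.2]) (by linarith [hu.1]) hr.le
    rw [add_zero, hzero t ht, ← sub_eq_add_neg] at hbelow
    linarith

/-- If `|φ'| ≤ K` and `F t` decreases at rate `m` near `φ t`, any `C` with `K < m * C` will do. -/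
theorem exists_strict_barriers_near_stable_branch {F : ℝ → ℝ → ℝ} {φ : ℝ → ℝ} {s : Set ℝ}
    (hs : UniqueDiffOn ℝ s) (hsc : IsCompact s) (hF : ContDiffOn ℝ 1 (uncurry F) (s ×ˢ univ))
    (hφ : ContDiffOn ℝ 1 φ s) (hzero : ∀ t ∈ s, F t (φ t) = 0)
    (hstable : ∀ t ∈ s, deriv (F t) (φ t) < 0) :
    ∃ ε₀ > 0, ∃ C > 0, ∀ ε > 0, ε < ε₀ → ∀ t ∈ s,
      derivWithin φ s t < ε⁻¹ * F t (φ t - C * ε) ∧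
        ε⁻¹ * F t (φ t + C * ε) < derivWithin φ s t := by
  obtain ⟨K, hK⟩ := hsc.exists_bound_of_continuousOn (hφ.continuousOn_derivWithin hs le_rfl)
  obtain ⟨m, hm, r, hr, hattract⟩ := exists_linear_bound_near_stable_branch hs hsc hF
    hφ.continuousOn hzero hstable
  set C : ℝ := (|K| + 1) / m with hCdef
  have hC : 0 < C := by positivity
  have hKC : K < m * C := by
    rw [hCdef, mul_div_cancel₀ _ hm.ne']
    exact (le_abs_self K).trans_lt (lt_add_one _)
  refine ⟨r / C, by positivity, C, hC, fun ε hε hεr t ht => ?_⟩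
  have hCε : C * ε ∈ Icc 0 r := ⟨by positivity, ((lt_div_iff₀' hC).1 hεr).le⟩
  have hscale : ε⁻¹ * (m * (C * ε)) = m * C := by field_simp
  obtain ⟨habove, hbelow⟩ := hattract t ht _ hCε
  constructor
  · calc derivWithin φ s t ≤ K := (le_abs_self _).trans (hK t ht)
      _ < ε⁻¹ * (m * (C * ε)) := hscale ▸ hKC
      _ ≤ ε⁻¹ * F t (φ t - C * ε) := by gcongr
  · calc ε⁻¹ * F t (φ t + C * ε) ≤ ε⁻¹ * -(m * (C * ε)) := by gcongr
      _ < -K := by rw [mul_neg, hscale]; exact neg_lt_neg hKC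
      _ ≤ derivWithin φ s t := neg_le_of_abs_le (hK t ht)

/-- A one-dimensional form of Tikhonov's theorem on slow manifolds. -/
theorem exists_solution_tracking_stable_branch {F : ℝ → ℝ → ℝ} {φ : ℝ → ℝ} {a b : ℝ} (hab : a < b)
    (hF : ContDiffOn ℝ 1 (uncurry F) (Icc a b ×ˢ univ)) (hφ : ContinuousOn φ (Icc a b))
    (hzero : ∀ t ∈ Icc a b, F t (φ t) = 0) (hstable : ∀ t ∈ Icc a b, deriv (F t) (φ t) < 0) :
    ∃ ε₀ > 0, ∃ C > 0, ∀ ε > 0, ε < ε₀ → ∃ y : ℝ → ℝ, y a = φ a ∧ ∀ t ∈ Icc a b,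
      HasDerivWithinAt y (ε⁻¹ * F t (y t)) (Icc a b) t ∧ |y t - φ t| ≤ C * ε := by
  have hI : UniqueDiffOn ℝ (Icc a b) := uniqueDiffOn_Icc hab
  have hφ1 : ContDiffOn ℝ 1 φ (Icc a b) :=
    contDiffOn_zero_branch hI hF hφ hzero fun t ht => (hstable t ht).ne
  have hφ' : ∀ t ∈ Icc a b, HasDerivWithinAt φ (derivWithin φ (Icc a b) t) (Icc a b) t :=
    fun t ht => (hφ1.differentiableOn one_ne_zero t ht).hasDerivWithinAt
  obtain ⟨ε₀, hε₀, C, hC, hbarrier⟩ :=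
    exists_strict_barriers_near_stable_branch hI isCompact_Icc hF hφ1 hzero hstable
  refine ⟨ε₀, hε₀, C, hC, fun ε hε hεε₀ => ?_⟩
  have hstrict := fun t (ht : t ∈ Ico a b) => hbarrier ε hε hεε₀ t (Ico_subset_Icc_self ht)
  have hCε : 0 < C * ε := mul_pos hC hε
  have hεF : ContDiffOn ℝ 1 (uncurry fun t x => ε⁻¹ * F t x) (Icc a b ×ˢ univ) :=
    contDiffOn_const.mul hF
  obtain ⟨L, hL⟩ := exists_forall_lipschitzOnWith_Icc hεF (hφ.sub continuousOn_const)
    (hφ.add continuousOn_const)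
  obtain ⟨y, hya, hy⟩ := exists_solution_between (f := fun t x => ε⁻¹ * F t x) (x₀ := φ a)
    (fun t ht => (hφ' t ht).sub_const (C * ε)) (fun t ht => (hφ' t ht).add_const (C * ε))
    (fun t _ => by linarith) (hεF.continuousOn.mono fun p hp => ⟨hp.1, mem_univ _⟩) hL
    (fun t ht => (hstrict t ht).1) (fun t ht => (hstrict t ht).2) hab.le
    ⟨by linarith, by linarith⟩
  refine ⟨y, hya, fun t ht => ⟨(hy t ht).1, abs_le.2 ⟨?_, ?_⟩⟩⟩
  · linarith [(hy t ht).2.1]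
  · linarith [(hy t ht).2.2]

theorem mFourierCoeff_const {d : Type*} [Fintype d] (c : ℂ) (k : d → ℤ) :
    UnitAddTorus.mFourierCoeff (fun _ => c) k = if k = 0 then c else 0 := by
  have hinner : UnitAddTorus.mFourierCoeff (fun _ => c) k =
      c * inner ℂ (UnitAddTorus.mFourierLp (d := d) 2 k) (UnitAddTorus.mFourierLp 2 0) := by
    simp only [ContinuousMap.inner_toLp, ← UnitAddTorus.mFourier_neg, UnitAddTorus.mFourier_zero,
      UnitAddTorus.mFourierCoeff, smul_eq_mul, integral_mul_const, ContinuousMap.one_apply, one_mul,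
      mul_comm c]
  rw [hinner, orthonormal_iff_ite.1 UnitAddTorus.orthonormal_mFourier]
  simp only [mul_ite, mul_one, mul_zero]

theorem sobolevH1Norm_const (c : ℝ) :
    sobolevH1Norm (fun _ => c) = ENNReal.ofReal |c| := by
  rw [sobolevH1Norm, if_pos (memLp_const c), tsum_eq_single 0]
  · rw [mFourierCoeff_const, if_pos rfl]
    simp only [Pi.zero_apply, Int.cast_zero]
    rw [← ENNReal.rpow_natCast, ENNReal.mul_rpow_of_nonneg _ _ (by norm_num), ← ENNReal.rpow_mul]
    simp [← ofReal_norm]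
  · intro k hk
    simp [mFourierCoeff_const, hk]

theorem isClassicalSolution_of_hasDerivWithinAt {T ε : ℝ} {F : ℝ → ℝ → ℝ} {y : ℝ → ℝ}
    (hy : ∀ t ∈ Icc 0 T, HasDerivWithinAt y (ε⁻¹ * F t (y t)) (Icc 0 T) t) :
    IsClassicalSolution T ε F fun t _ => y t where
  contDiff_space t _ := contDiff_const
  continuousOn_deriv k _ := by
    have hyc : ContinuousOn (fun p : ℝ × EuclideanSpace ℝ (Fin 2) => y p.1) (Icc 0 T ×ˢ univ) :=
      (HasDerivWithinAt.continuousOn hy).comp continuousOn_fst fun p hp => hp.1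
    change ContinuousOn (fun p : ℝ × EuclideanSpace ℝ (Fin 2) =>
      iteratedFDeriv ℝ k (fun _ => y p.1) p.2) _
    rcases eq_or_ne k 0 with rfl | hk
    · exact (continuousMultilinearCurryFin0 ℝ _ ℝ).symm.continuous.comp_continuousOn hyc
    · simp only [iteratedFDeriv_const_of_ne hk]
      exact continuousOn_const
  equation t ht x := by
    have hlift : ∀ t, periodicLift (fun _ => y t) = fun _ => y t := fun _ => rfl
    simpa [hlift] using hy t ht

theorem contDiffOn_forcing {n : ℕ} {A : Fin (n + 1) → ℝ → ℝ} {s : Set ℝ} {k : WithTop ℕ∞}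
    (hA : ∀ j, ContDiffOn ℝ k (A j) s) : ContDiffOn ℝ k (uncurry (forcing A)) (s ×ˢ univ) := by
  change ContDiffOn ℝ k (fun p : ℝ × ℝ => ∑ j, A j p.1 * p.2 ^ (j : ℕ)) (s ×ˢ univ)
  refine ContDiffOn.sum fun j _ => ?_
  exact ((hA j).comp contDiffOn_fst fun _ hp => hp.1).mul (contDiffOn_snd.pow _)

theorem proposition2p5_general {T : ℝ} (hT : 0 < T) {F : ℝ → ℝ → ℝ}
    (hF : ContDiffOn ℝ 1 (uncurry F) (Icc 0 T ×ˢ univ)) {φstar : ℝ → ℝ}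
    (hcont : ContinuousOn φstar (Icc 0 T)) (hzero : ∀ t ∈ Icc 0 T, F t (φstar t) = 0)
    (hstable : ∀ t ∈ Icc 0 T, deriv (F t) (φstar t) < 0) :
    ∃ ε₀ : ℝ, 0 < ε₀ ∧ ∃ C : ℝ, 0 < C ∧ ∀ ε : ℝ, 0 < ε → ε < ε₀ →
      ∃ φbar : ℝ → Torus2 → ℝ,
        IsClassicalSolution T ε F φbar ∧
        ∀ t ∈ Icc 0 T,
          sobolevH1Norm (fun x => φbar t x - φstar t) ≤ ENNReal.ofReal (C * ε) := by
  obtain ⟨ε₀, hε₀, C, hC, htrack⟩ :=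
    exists_solution_tracking_stable_branch hT hF hcont hzero hstable
  refine ⟨ε₀, hε₀, C, hC, fun ε hε hεε₀ => ?_⟩
  obtain ⟨y, -, hy⟩ := htrack ε hε hεε₀
  refine ⟨fun t _ => y t, isClassicalSolution_of_hasDerivWithinAt fun t ht => (hy t ht).1,
    fun t ht => ?_⟩
  rw [sobolevH1Norm_const]
  exact ENNReal.ofReal_le_ofReal (hy t ht).2

theorem proposition2p5
    (T : ℝ) (hT : 0 < T)
    (n : ℕ) (hn : 3 ≤ n) (hodd : Odd n)
    (A : Fin (n + 1) → ℝ → ℝ)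
    (hA : ∀ j, ContDiffOn ℝ 1 (A j) (Set.Icc 0 T))
    (hlead : ∀ t ∈ Set.Icc 0 T, A (Fin.last n) t < 0)
    (φstar : ℝ → ℝ) (hcont : ContinuousOn φstar (Set.Icc 0 T))
    (hzero : ∀ t ∈ Set.Icc 0 T, forcing A t (φstar t) = 0)
    (am ap : ℝ) (ham : 0 < am) (hap : am < ap)
    (hstable : ∀ t ∈ Set.Icc 0 T,
      -ap < deriv (fun y => forcing A t y) (φstar t) ∧
        deriv (fun y => forcing A t y) (φstar t) < -am) :
    ∃ ε₀ : ℝ, 0 < ε₀ ∧ ∃ C : ℝ, 0 < C ∧ ∀ ε : ℝ, 0 < ε → ε < ε₀ →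
      ∃ φbar : ℝ → Torus2 → ℝ,
        IsClassicalSolution T ε (forcing A) φbar ∧
        ∀ t ∈ Set.Icc 0 T,
          sobolevH1Norm (fun x => φbar t x - φstar t) ≤ ENNReal.ofReal (C * ε) :=
  proposition2p5_general hT (contDiffOn_forcing hA) hcont hzero
    fun t ht => (hstable t ht).2.trans (neg_lt_zero.2 ham)
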